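/- For a positive integer $n$, the augmented cube $AQ_n$ is the graph whose vertices are the $2^n$ binary strings $x_nx_{n-1}\cdots x_1$, defined recursively: $AQ_1$ is the complete graph on $\{0,1\}$, and for $n\ge 2$ the graph $AQ_n$ consists of two disjoint copies of $AQ_{n-1}$, one on the strings with $x_n=0$ and one on the strings with $x_n=1$, together with an edge between $0x_{n-1}\cdots x_1$ and $1y_{n-1}\cdots y_1$ if and only if either $x_i=y_i$ for all $1\le i\le n-1$, or $x_i=1-y_i$ for all $1\le i\le n-1$. For an integer $h\ge 0$, an $h$-vertex-cut of a finite graph $G$ is a set $S$ of vertices such that $G-S$ is disconnected and every connected component of $G-S$ has more than $h$ vertices; the $h$-extra connectivity $\kappa_h(G)$ is the minimum cardinality of an $h$-vertex-cut of $G$ (and $+\infty$ if there is none). **Theorem.** For every integer $n\ge 9$, $$\kappa_2(AQ_n)=6n-17 .$$ -/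

import Mathlib

/-- The `n`-dimensional augmented cube `AQ n`. A vertex `x : Fin n → Bool` is the binary string
`xₙ ⋯ x₂ x₁`, the bit `xᵢ` being `x` at the index `i - 1`; in particular the leading bit of a
string of length `n + 1` is `x (Fin.last n)`, and the string without its leading bit is
`Fin.init x`. Two strings with the same leading bit are adjacent iff their remainders are adjacent
in the smaller cube; two strings with different leading bits are adjacent iff their remainders
are equal or are bitwise complements of each other. The recursion starts from the
one-vertex graph in dimension `0`, so that `AQ 1` is the complete graph on two vertices. -/
def AQ : (n : ℕ) → SimpleGraph (Fin n → Bool)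
  | 0 => ⊥
  | n + 1 =>
    { Adj := fun x y =>
        (x (Fin.last n) = y (Fin.last n) ∧ (AQ n).Adj (Fin.init x) (Fin.init y)) ∨
        (x (Fin.last n) ≠ y (Fin.last n) ∧
          ((∀ i, Fin.init x i = Fin.init y i) ∨ (∀ i, Fin.init x i = !Fin.init y i)))
      symm := ⟨by
        rintro x y (⟨h, h'⟩ | ⟨h, h' | h'⟩)
        · exact Or.inl ⟨h.symm, h'.symm⟩
        · exact Or.inr ⟨h.symm, Or.inl fun i => (h' i).symm⟩
        · exact Or.inr ⟨h.symm, Or.inr fun i => by simp [h' i]⟩⟩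
      loopless := ⟨by
        rintro x (⟨-, h⟩ | ⟨h, -⟩)
        · exact (AQ n).loopless.irrefl _ h
        · exact h rfl⟩ }

/-- The finite vertex set `S` is an `h`-vertex-cut of `G`: the graph `G - S` is disconnected
(it has two vertices not joined by a path), and each of its components has more than
`h` vertices. -/
structure IsExtraVertexCut {V : Type*} (G : SimpleGraph V) (h : ℕ) (S : Finset V) : Prop where
  disconnected : ¬ (G.induce ((S : Set V)ᶜ)).Preconnected
  lt_encard : ∀ C : (G.induce ((S : Set V)ᶜ)).ConnectedComponent, (h : ℕ∞) < C.supp.encard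

/-- The `h`-extra connectivity of `G`: the minimum cardinality of an `h`-vertex-cut of `G`
(`⊤` if there is none). -/
noncomputable def extraConnectivity {V : Type*} (h : ℕ) (G : SimpleGraph V) : ℕ∞ :=
  ⨅ (S : Finset V) (_ : IsExtraVertexCut G h S), (S.card : ℕ∞)

/-!
The `h`-extra connectivity is an isoperimetric quantity: a cut `S` splits the remaining vertices
into two sets `A` and `B` of at least three vertices with no edge between them (`Separated A B`), so
the lower bound says that such a pair satisfies `|A| + |B| + (6n - 17) ≤ 2 ^ n`. No connectedness of
`A` or `B` is needed for this.

The proof cuts the cube into its two halves. The two slices of a separated pair are separated, and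
every vertex of one half is joined in the other half to its mirror images, the same string and the
complementary one. A vertex has degree `2n - 1`, and two vertices have at most four common
neighbours if they are not adjacent, and at most four besides themselves in any case; so sets with
one or two elements have at least `2n - 1` or `4n - 8` neighbours. If in no half both slices have at
least three elements, either one side has at most two elements in each half, and these bounds
suffice, or `A` is large in one half and `B` in the other, and then the mirror images of each, which
must avoid the other, leave too many vertices outside (`Separated.card_add_le_succ`). If in some
half both slices have at least three elements, the slices in that half already miss almost the
required number of vertices, and at most six vertices are left for the other half. A pair of
nonempty sets would miss at least seven, so `A`, say, lies in a single half; then it has at most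
six mirror images.

What remains is a small set `A` in a single half. In general this half misses at least `6n - 24`
vertices (one less than the induction hypothesis would give, since in dimension five the bound
`6n - 17` fails; see `Separated.card_add_le_weak`), and at least seven mirror images make up for it.
A set with at most six mirror images contains complementary pairs, unless it has three elements,
and so meets both quarters of its half, where the bounds for one, two and three vertices give
enough neighbours. Three vertices have at least `6n - 17` neighbours by a direct induction.

For the upper bound, three vertices of a path have exactly `6n - 17` neighbours in a suitable
position, and any other vertex has too many neighbours for its component to become small.
-/

open Finset

/-! ### The two halves of the cube -/

/-- The string `x` with the leading bit `b` put in front. -/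
def withBit {n : ℕ} (b : Bool) (x : Fin n → Bool) : Fin (n + 1) → Bool :=
  Fin.snoc (α := fun _ => Bool) x b

/-- The part of `A` in the half-cube with leading bit `b`, with that bit removed. -/
def half {n : ℕ} (b : Bool) (A : Finset (Fin (n + 1) → Bool)) : Finset (Fin n → Bool) :=
  univ.filter fun x => withBit b x ∈ A

@[simp] lemma mem_half {n : ℕ} {b : Bool} {A : Finset (Fin (n + 1) → Bool)} {x : Fin n → Bool} :
    x ∈ half b A ↔ withBit b x ∈ A := by simp [half]

lemma exists_withBit {n : ℕ} (v : Fin (n + 1) → Bool) : ∃ b x, v = withBit b x :=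
  ⟨v (Fin.last n), Fin.init v, (Fin.snoc_init_self (α := fun _ => Bool) v).symm⟩

@[simp] lemma withBit_inj {n : ℕ} {b c : Bool} {x y : Fin n → Bool} :
    withBit b x = withBit c y ↔ b = c ∧ x = y := by
  rw [withBit, withBit, Fin.snoc_inj, and_comm]

lemma withBit_injective {n : ℕ} (b : Bool) :
    Function.Injective (withBit b : (Fin n → Bool) → _) := fun _ _ h => (withBit_inj.1 h).2

@[simp] lemma compl_withBit {n : ℕ} (b : Bool) (x : Fin n → Bool) :
    (withBit b x)ᶜ = withBit (!b) xᶜ := by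
  ext i
  refine Fin.lastCases ?_ (fun j => ?_) i <;> simp [withBit]

lemma compl_ne {n : ℕ} (x : Fin (n + 1) → Bool) : xᶜ ≠ x := fun h => by
  have := congrFun h 0
  simp at this

lemma card_half_add {n : ℕ} (b : Bool) (A : Finset (Fin (n + 1) → Bool)) :
    (half b A).card + (half (!b) A).card = A.card := by
  classical
  have h : A = (half b A).image (withBit b) ∪ (half (!b) A).image (withBit (!b)) := by
    ext v
    obtain ⟨c, x, rfl⟩ := exists_withBit v
    cases b <;> cases c <;> simp
  conv_rhs => rw [h]
  rw [card_union_of_disjoint, card_image_of_injective _ (withBit_injective _),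
    card_image_of_injective _ (withBit_injective _)]
  rw [disjoint_left]
  intro v hv hw
  obtain ⟨x, -, rfl⟩ := mem_image.1 hv
  obtain ⟨y, -, h⟩ := mem_image.1 hw
  cases b <;> simp at h

lemma AQ_adj_withBit {n : ℕ} {b c : Bool} {x y : Fin n → Bool} :
    (AQ (n + 1)).Adj (withBit b x) (withBit c y) ↔
      (b = c ∧ (AQ n).Adj x y) ∨ (b ≠ c ∧ (y = x ∨ y = xᶜ)) := by
  have h1 : (∀ i, x i = y i) ↔ y = x := by rw [funext_iff]; simp only [eq_comm]
  have h2 : (∀ i, x i = !y i) ↔ y = xᶜ := by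
    rw [funext_iff]
    refine forall_congr' fun i => ?_
    simp only [Pi.compl_apply]
    cases x i <;> cases y i <;> simp
  rw [← h1, ← h2]
  simp [AQ, withBit, Fin.init_snoc, Fin.snoc_last]

/-! ### Closed neighbourhoods -/

/-- Adjacency decided along the recursion, so that the kernel can evaluate it. -/
instance decidableAQ : (n : ℕ) → DecidableRel (AQ n).Adj
  | 0 => fun _ _ => isFalse id
  | n + 1 => fun x y =>
    haveI := decidableAQ n
    inferInstanceAs (Decidable ((x (Fin.last n) = y (Fin.last n) ∧
        (AQ n).Adj (Fin.init x) (Fin.init y)) ∨ (x (Fin.last n) ≠ y (Fin.last n) ∧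
          ((∀ i, Fin.init x i = Fin.init y i) ∨ (∀ i, Fin.init x i = !Fin.init y i)))))

/-- The closed neighbourhood of `v` in `AQ n`: the vertex `v` together with its neighbours. -/
def closedNbhd {n : ℕ} (v : Fin n → Bool) : Finset (Fin n → Bool) :=
  univ.filter fun w => w = v ∨ (AQ n).Adj v w

@[simp] lemma mem_closedNbhd {n : ℕ} {v w : Fin n → Bool} :
    w ∈ closedNbhd v ↔ w = v ∨ (AQ n).Adj v w := by simp [closedNbhd]

lemma half_closedNbhd_self {n : ℕ} (b : Bool) (x : Fin n → Bool) :
    half b (closedNbhd (withBit b x)) = closedNbhd x := by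
  ext y
  simp [AQ_adj_withBit]

lemma half_closedNbhd_not {n : ℕ} (b : Bool) (x : Fin n → Bool) :
    half (!b) (closedNbhd (withBit b x)) = {x, xᶜ} := by
  ext y
  simp [AQ_adj_withBit]

lemma card_closedNbhd {n : ℕ} (v : Fin (n + 1) → Bool) : (closedNbhd v).card = 2 * (n + 1) := by
  induction n with
  | zero =>
    obtain ⟨b, x, rfl⟩ := exists_withBit v
    rw [← card_half_add b, half_closedNbhd_self, half_closedNbhd_not]
    have h : closedNbhd x = {x} := by
      ext y
      simp [Subsingleton.elim y x]
    simp [h, Subsingleton.elim xᶜ x]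
  | succ n ih =>
    obtain ⟨b, x, rfl⟩ := exists_withBit v
    rw [← card_half_add b, half_closedNbhd_self, half_closedNbhd_not, ih,
      card_pair (compl_ne x).symm]
    ring

lemma half_inter {n : ℕ} (b : Bool) (A B : Finset (Fin (n + 1) → Bool)) :
    half b (A ∩ B) = half b A ∩ half b B := by
  ext; simp

lemma half_union {n : ℕ} (b : Bool) (A B : Finset (Fin (n + 1) → Bool)) :
    half b (A ∪ B) = half b A ∪ half b B := by
  ext; simp

/-- Vertices in different halves have at most two common closed neighbours in either half. -/
lemma card_closedNbhd_inter_le_of_ne {n : ℕ} {b c : Bool} (h : b ≠ c) (x y : Fin n → Bool) :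
    (closedNbhd (withBit b x) ∩ closedNbhd (withBit c y)).card ≤ 4 := by
  obtain rfl : c = !b := by cases b <;> cases c <;> simp_all
  rw [← card_half_add b, half_inter, half_inter, half_closedNbhd_self, half_closedNbhd_not,
    half_closedNbhd_self]
  have h1 := half_closedNbhd_not (!b) y
  rw [Bool.not_not] at h1
  rw [h1]
  exact Nat.add_le_add ((card_le_card inter_subset_right).trans card_le_two)
    ((card_le_card inter_subset_left).trans card_le_two)

lemma card_closedNbhd_inter_le {n : ℕ} {v w : Fin n → Bool} (h : v ≠ w) :
    (closedNbhd v ∩ closedNbhd w).card ≤ 4 ∨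
      (AQ n).Adj v w ∧ (closedNbhd v ∩ closedNbhd w).card ≤ 6 := by
  induction n with
  | zero => exact absurd (Subsingleton.elim v w) h
  | succ n ih =>
    obtain ⟨b, x, rfl⟩ := exists_withBit v
    obtain ⟨c, y, rfl⟩ := exists_withBit w
    rcases ne_or_eq b c with hbc | rfl
    · exact Or.inl (card_closedNbhd_inter_le_of_ne hbc x y)
    have hxy : x ≠ y := fun e => h (by rw [e])
    rw [← card_half_add b, half_inter, half_inter, half_closedNbhd_self,
      half_closedNbhd_self, half_closedNbhd_not, half_closedNbhd_not, AQ_adj_withBit]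
    by_cases hc : y = xᶜ
    · -- complementary strings are adjacent and lie in different halves of the smaller cube
      obtain _ | m := n
      · exact absurd (Subsingleton.elim x y) hxy
      obtain ⟨d, u, rfl⟩ := exists_withBit x
      subst hc
      have h4 := card_closedNbhd_inter_le_of_ne (b := d) (c := !d) (by simp) u uᶜ
      have h2 : (({withBit d u, (withBit d u)ᶜ} : Finset (Fin (m + 1) → Bool)) ∩
          {(withBit d u)ᶜ, (withBit d u)ᶜᶜ}).card ≤ 2 :=
        (card_le_card inter_subset_left).trans card_le_two
      rw [← compl_withBit] at h4
      refine Or.inr ⟨Or.inl ⟨rfl, ?_⟩, by omega⟩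
      rw [compl_withBit, AQ_adj_withBit]
      exact Or.inr ⟨by simp, Or.inr rfl⟩
    · have h0 : ({x, xᶜ} : Finset (Fin n → Bool)) ∩ {y, yᶜ} = ∅ := by
        ext z
        simp only [mem_inter, mem_insert, mem_singleton, notMem_empty, iff_false]
        rintro ⟨rfl | rfl, h' | h'⟩
        · exact hxy h'
        · exact hc (by rw [h', compl_compl])
        · exact hc h'.symm
        · exact hxy (compl_injective h')
      simpa [h0] using ih hxy

/-! ### Separated pairs and small sets -/

/-- `A` and `B` are disjoint and no edge of `AQ n` joins them. -/
def Separated {n : ℕ} (A B : Finset (Fin n → Bool)) : Prop :=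
  ∀ a ∈ A, ∀ b ∈ B, b ∉ closedNbhd a

namespace Separated

variable {n : ℕ}

lemma symm {A B : Finset (Fin n → Bool)} (h : Separated A B) : Separated B A := by
  intro b hb a ha hab
  refine h a ha b hb ?_
  rw [mem_closedNbhd] at hab ⊢
  exact hab.imp Eq.symm SimpleGraph.Adj.symm

lemma restrict_half {A B : Finset (Fin (n + 1) → Bool)} (h : Separated A B) (b : Bool) :
    Separated (half b A) (half b B) := by
  intro x hx y hy hxy
  refine h _ (mem_half.1 hx) _ (mem_half.1 hy) ?_
  rwa [← mem_half, half_closedNbhd_self]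

lemma card_add_card_le {A B : Finset (Fin n → Bool)} (h : Separated A B) :
    A.card + B.card ≤ 2 ^ n := by
  rw [← card_union_of_disjoint]
  · simpa using card_le_univ (A ∪ B)
  · rw [disjoint_left]
    exact fun a ha hb => h a ha a hb (by simp)

lemma card_add_le_of_mem {A B : Finset (Fin (n + 1) → Bool)} (h : Separated A B)
    {a : Fin (n + 1) → Bool} (ha : a ∈ A) : B.card + 2 * (n + 1) ≤ 2 ^ (n + 1) := by
  rw [← card_closedNbhd a, ← card_union_of_disjoint]
  · simpa using card_le_univ (B ∪ closedNbhd a)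
  · rw [disjoint_left]
    exact fun b hb => h a ha b hb

lemma card_add_le_of_card_eq_two {A B : Finset (Fin (n + 1) → Bool)} (h : Separated A B)
    (hA : A.card = 2) : B.card + 4 * (n + 1) ≤ 2 ^ (n + 1) + 6 := by
  obtain ⟨a, c, hac, rfl⟩ := card_eq_two.1 hA
  have h1 := card_union_add_card_inter (closedNbhd a) (closedNbhd c)
  rw [card_closedNbhd, card_closedNbhd] at h1
  have h2 := card_closedNbhd_inter_le hac
  have h3 : B.card + (closedNbhd a ∪ closedNbhd c).card ≤ 2 ^ (n + 1) := by
    rw [← card_union_of_disjoint]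
    · simpa using card_le_univ (B ∪ (closedNbhd a ∪ closedNbhd c))
    · rw [disjoint_left]
      intro b hb hb'
      rcases mem_union.1 hb' with hb' | hb'
      · exact h a (by simp) b hb hb'
      · exact h c (by simp) b hb hb'
  omega

/-- If `A` and `B` are separated, the strings of one half of `A` and their complements occur in
the other half only in `A` or outside `A ∪ B`. -/
lemma card_mirror_add_le {A B : Finset (Fin (n + 1) → Bool)} (h : Separated A B) (b : Bool) :
    (half b A ∪ (half b A).compls).card + (half (!b) B).card ≤ 2 ^ n := by
  rw [← card_union_of_disjoint]
  · simpa using card_le_univ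
      (half b A ∪ (half b A).compls ∪ half (!b) B)
  · rw [disjoint_left]
    intro x hx hy
    obtain ⟨y, hyA, hyx⟩ : ∃ y ∈ half b A, x ∈ ({y, yᶜ} : Finset _) := by
      rcases mem_union.1 hx with hx | hx
      · exact ⟨x, hx, by simp⟩
      · exact ⟨xᶜ, mem_compls.1 hx, by simp⟩
    refine h _ (mem_half.1 hyA) _ (mem_half.1 hy) ?_
    rwa [← mem_half, half_closedNbhd_not]

lemma card_half_add_card_half_le {A B : Finset (Fin (n + 1) → Bool)} (h : Separated A B)
    (b : Bool) : (half b A).card + (half (!b) B).card ≤ 2 ^ n :=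
  (Nat.add_le_add_right (card_le_card subset_union_left) _).trans (h.card_mirror_add_le b)

end Separated

lemma two_mul_card_half_le {n : ℕ} (A : Finset (Fin (n + 1) → Bool)) (b : Bool) :
    2 * (half b A).card ≤ (A ∪ A.compls).card := by
  rw [← card_half_add b (A ∪ A.compls)]
  have h1 : (half b A).card ≤ (half b (A ∪ A.compls)).card :=
    card_le_card fun x hx => by simp_all
  have h2 : (half b A).card ≤ (half (!b) (A ∪ A.compls)).card := by
    rw [← card_compls (half b A)]
    exact card_le_card fun x hx => by simp_all [mem_compls]
  omega

namespace Separated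

variable {n : ℕ}

/-! ### Nonempty separated pairs -/

lemma card_add_four_le_of_three {A B : Finset (Fin 3 → Bool)} (h : Separated A B)
    (hA : A.Nonempty) (hB : B.Nonempty) : A.card + B.card + 4 ≤ 2 ^ 3 := by
  obtain ⟨a, ha⟩ := hA
  obtain ⟨b, hb⟩ := hB
  have h1 := h.card_add_le_of_mem ha
  have h2 := h.symm.card_add_le_of_mem hb
  omega

lemma card_add_seven_le_succ (hn : 3 ≤ n)
    (ih : ∀ A B : Finset (Fin n → Bool), Separated A B → A.Nonempty → B.Nonempty →
      A.card + B.card + 4 ≤ 2 ^ n)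
    {A B : Finset (Fin (n + 1) → Bool)} (h : Separated A B)
    (hA : A.Nonempty) (hB : B.Nonempty) : A.card + B.card + 7 ≤ 2 ^ (n + 1) := by
  have hN : 2 ^ 3 ≤ 2 ^ n := Nat.pow_le_pow_right (by norm_num) hn
  simp only [← card_pos] at ih hA hB
  obtain ⟨a, ha⟩ := card_pos.1 hA
  obtain ⟨b, hb⟩ := card_pos.1 hB
  have d1 := h.card_add_le_of_mem ha
  have d2 := h.symm.card_add_le_of_mem hb
  have e1 := h.card_add_le_of_card_eq_two
  have e2 := h.symm.card_add_le_of_card_eq_two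
  have i0 := ih _ _ (h.restrict_half false)
  have i1 := ih _ _ (h.restrict_half true)
  have p0 := (h.restrict_half false).card_add_card_le
  have p1 := (h.restrict_half true).card_add_card_le
  have m0 := h.card_half_add_card_half_le false
  have m1 := h.card_half_add_card_half_le true
  have cA := card_half_add false A
  have cB := card_half_add false B
  simp only [Bool.not_false, Bool.not_true] at m0 m1 cA cB
  rw [pow_succ] at *
  omega

lemma card_add_seven_le (hn : 4 ≤ n) {A B : Finset (Fin n → Bool)} (h : Separated A B)
    (hA : A.Nonempty) (hB : B.Nonempty) : A.card + B.card + 7 ≤ 2 ^ n := by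
  induction n, hn using Nat.le_induction with
  | base =>
    exact card_add_seven_le_succ le_rfl (fun _ _ => card_add_four_le_of_three) h hA hB
  | succ n hn ih =>
    refine card_add_seven_le_succ (by omega) (fun A B h hA hB => ?_) h hA hB
    have := ih h hA hB
    omega

/-! ### Separated pairs with at least three vertices on each side -/

/-- The exceptional sets, of at least three strings, that together with their complements make up
fewer than six strings: both halves of `A` have one or two elements, and so many neighbours. -/
lemma card_add_le_of_card_mirror_le {A B : Finset (Fin (n + 2) → Bool)} (h : Separated A B)
    (hA : 3 ≤ A.card) (hM : (A ∪ A.compls).card ≤ 5) :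
    A.card = 3 ∧ A.card + B.card + 6 * (n + 2) ≤ 2 ^ (n + 2) + 15 ∨
      A.card = 4 ∧ A.card + B.card + 8 * (n + 2) ≤ 2 ^ (n + 2) + 24 := by
  have s0 := two_mul_card_half_le A false
  have s1 := two_mul_card_half_le A true
  have cA := card_half_add false A
  have cB := card_half_add false B
  simp only [Bool.not_false] at cA cB
  obtain ⟨a, ha⟩ := card_pos.1 (by omega : 0 < (half false A).card)
  obtain ⟨b, hb⟩ := card_pos.1 (by omega : 0 < (half true A).card)
  have d0 := (h.restrict_half false).card_add_le_of_mem ha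
  have d1 := (h.restrict_half true).card_add_le_of_mem hb
  have e0 := (h.restrict_half false).card_add_le_of_card_eq_two
  have e1 := (h.restrict_half true).card_add_le_of_card_eq_two
  rw [pow_succ 2 (n + 1)]
  omega

/-- The inductive step of the lower bounds, reducing them to the case in which one of the two sides
lies in a single half of the cube. -/
lemma card_add_le_succ {t : ℕ} (ht : 17 ≤ t) (hn : 3 ≤ n)
    (ih : ∀ A B : Finset (Fin (n + 1) → Bool), Separated A B → 3 ≤ A.card → 3 ≤ B.card →
      A.card + B.card + 6 * (n + 1) ≤ 2 ^ (n + 1) + 18)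
    (key : ∀ b : Bool, ∀ A B : Finset (Fin (n + 2) → Bool), Separated A B →
      3 ≤ (half b A).card → 3 ≤ (half b B).card → (half (!b) A).card = 0 →
      A.card + B.card + 6 * (n + 2) ≤ 2 ^ (n + 2) + t)
    {A B : Finset (Fin (n + 2) → Bool)} (h : Separated A B)
    (hA : 3 ≤ A.card) (hB : 3 ≤ B.card) : A.card + B.card + 6 * (n + 2) ≤ 2 ^ (n + 2) + t := by
  have pw : 2 ^ (n + 2) = 2 * 2 ^ (n + 1) := by ring
  have both (b : Bool) (hAb : 3 ≤ (half b A).card) (hBb : 3 ≤ (half b B).card) :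
      A.card + B.card + 6 * (n + 2) ≤ 2 ^ (n + 2) + t := by
    have i := ih _ _ (h.restrict_half b) hAb hBb
    have cA := card_half_add b A
    have cB := card_half_add b B
    have q := (h.restrict_half !b).card_add_seven_le (by omega)
    simp only [← card_pos] at q
    by_cases hA0 : (half (!b) A).card = 0
    · exact key b A B h hAb hBb hA0
    by_cases hB0 : (half (!b) B).card = 0
    · have := key b B A h.symm hBb hAb hB0
      omega
    · have := q (by omega) (by omega)
      omega
  by_cases h0 : 3 ≤ (half false A).card ∧ 3 ≤ (half false B).card
  · exact both false h0.1 h0.2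
  by_cases h1 : 3 ≤ (half true A).card ∧ 3 ≤ (half true B).card
  · exact both true h1.1 h1.2
  have f (b : Bool) {A B : Finset (Fin (n + 2) → Bool)} (h : Separated A B) :
      (half b A).card = 0 ∨
      (half b A).card = 1 ∧ (half b B).card + 2 * (n + 1) ≤ 2 ^ (n + 1) ∨
      (half b A).card = 2 ∧ (half b B).card + 4 * (n + 1) ≤ 2 ^ (n + 1) + 6 ∨
      3 ≤ (half b A).card := by
    rcases Nat.eq_zero_or_pos (half b A).card with h0 | h0
    · exact Or.inl h0
    obtain ⟨a, ha⟩ := card_pos.1 h0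
    have d := (h.restrict_half b).card_add_le_of_mem ha
    have e := (h.restrict_half b).card_add_le_of_card_eq_two
    omega
  -- the bounds for one and two vertices, and the mirror images when `A` and `B` are large in
  -- different halves
  have fA0 := f false h
  have fA1 := f true h
  have fB0 := f false h.symm
  have fB1 := f true h.symm
  have p0 := (h.restrict_half false).card_add_card_le
  have p1 := (h.restrict_half true).card_add_card_le
  have m0 := h.card_half_add_card_half_le false
  have m1 := h.card_half_add_card_half_le true
  have cA := card_half_add false A
  have cB := card_half_add false B
  simp only [Bool.not_false, Bool.not_true] at m0 m1 cA cB
  -- in the smallest dimension `2 ^ (n + 1)` is too small for the uniform estimate, and the number of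
  -- neighbours of the small slices is used instead
  have hN : n = 3 ∧ 2 ^ (n + 1) = 16 ∨ 6 * (n + 1) ≤ 2 ^ (n + 1) + 7 ∧ 4 ≤ n := by
    rcases hn.eq_or_lt with rfl | hn
    · exact Or.inl ⟨rfl, rfl⟩
    · refine Or.inr ⟨?_, hn⟩
      clear * - hn
      induction n, hn using Nat.le_induction with
      | base => norm_num
      | succ n hn ih => rw [pow_succ]; omega
  rw [pw]
  clear pw
  generalize 2 ^ (n + 1) = N at *
  clear ih key both
  omega

lemma card_add_le_weak_of_half_eq_zero (hn : 2 ≤ n)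
    (ih : ∀ A B : Finset (Fin (n + 2) → Bool), Separated A B → 3 ≤ A.card → 3 ≤ B.card →
      A.card + B.card + 6 * (n + 2) ≤ 2 ^ (n + 2) + 18) (b : Bool)
    (A B : Finset (Fin (n + 3) → Bool)) (h : Separated A B) (hA : 3 ≤ (half b A).card)
    (hB : 3 ≤ (half b B).card) (h0 : (half (!b) A).card = 0) :
    A.card + B.card + 6 * (n + 3) ≤ 2 ^ (n + 3) + 18 := by
  have s0 := two_mul_card_half_le (half b A) false
  have s1 := two_mul_card_half_le (half b A) true
  have c := card_half_add false (half b A)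
  have m := h.card_mirror_add_le b
  have i := ih _ _ (h.restrict_half b) hA hB
  have ex := (h.restrict_half b).card_add_le_of_card_mirror_le hA
  have cA := card_half_add b A
  have cB := card_half_add b B
  have pw : 2 ^ (n + 3) = 2 * 2 ^ (n + 2) := by ring
  simp only [Bool.not_false] at c
  omega

/-- The lower bound up to one vertex, which holds in all dimensions from `4` on. In dimension `5`
it is attained: four vertices, a coset of a subgroup of order four, have only `12` neighbours. -/
lemma card_add_le_weak (hn : 4 ≤ n) {A B : Finset (Fin n → Bool)} (h : Separated A B)
    (hA : 3 ≤ A.card) (hB : 3 ≤ B.card) : A.card + B.card + 6 * n ≤ 2 ^ n + 18 := by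
  induction n, hn using Nat.le_induction with
  | base =>
    have := h.card_add_seven_le le_rfl (card_pos.1 (by omega)) (card_pos.1 (by omega))
    omega
  | succ n hn ih =>
    obtain ⟨m, rfl⟩ : ∃ m, n = m + 2 := ⟨n - 2, by omega⟩
    have ih' : ∀ A B : Finset (Fin (m + 2) → Bool), Separated A B → 3 ≤ A.card → 3 ≤ B.card →
      A.card + B.card + 6 * (m + 2) ≤ 2 ^ (m + 2) + 18 := fun _ _ h hA hB => ih h hA hB
    exact card_add_le_succ (by norm_num) (by omega) ih'
      (card_add_le_weak_of_half_eq_zero (by omega) ih') h hA hB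

lemma card_add_le_of_card_eq_three {A B : Finset (Fin n → Bool)} (h : Separated A B)
    (hA : A.card = 3) : B.card + 6 * n ≤ 2 ^ n + 14 := by
  induction n with
  | zero =>
    have := h.card_add_card_le
    omega
  | succ n ih =>
    have single (b : Bool) (hb : (half b A).card = 3) :
        B.card + 6 * (n + 1) ≤ 2 ^ (n + 1) + 14 := by
      have hN := (h.restrict_half b).card_add_card_le
      obtain _ | _ | n := n
      · omega
      · omega
      have m := h.card_mirror_add_le b
      have i := ih (h.restrict_half b) hb
      have ex := (h.restrict_half b).card_add_le_of_card_mirror_le (by omega)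
      have s0 := two_mul_card_half_le (half b A) false
      have s1 := two_mul_card_half_le (half b A) true
      have c := card_half_add false (half b A)
      have cB := card_half_add b B
      have pw : 2 ^ (n + 2) = 4 * 2 ^ n := by ring
      simp only [Bool.not_false] at c
      omega
    have cA := card_half_add false A
    have cB := card_half_add false B
    simp only [Bool.not_false] at cA cB
    by_cases h0 : (half false A).card = 3
    · exact single false h0
    by_cases h1 : (half true A).card = 3
    · exact single true h1
    obtain ⟨a, ha⟩ := card_pos.1 (by omega : 0 < (half false A).card)
    obtain ⟨b, hb⟩ := card_pos.1 (by omega : 0 < (half true A).card)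
    have hN := (h.restrict_half false).card_add_card_le
    have hN' := (h.restrict_half true).card_add_card_le
    obtain _ | n := n
    · omega
    have d0 := (h.restrict_half false).card_add_le_of_mem ha
    have d1 := (h.restrict_half true).card_add_le_of_mem hb
    have e0 := (h.restrict_half false).card_add_le_of_card_eq_two
    have e1 := (h.restrict_half true).card_add_le_of_card_eq_two
    have pw : 2 ^ (n + 2) = 2 * 2 ^ (n + 1) := by ring
    omega

/-- Four to six strings that together with their complements make up only six strings: both halves
of `A` are nonempty and have at most three elements. -/
lemma card_add_le_of_card_mirror_eq_six {A B : Finset (Fin (n + 2) → Bool)} (hn : 3 ≤ n)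
    (h : Separated A B) (hA : 4 ≤ A.card) (hM : (A ∪ A.compls).card = 6) :
    A.card + B.card + 6 * (n + 2) ≤ 2 ^ (n + 2) + 17 := by
  have s0 := two_mul_card_half_le A false
  have s1 := two_mul_card_half_le A true
  have cA := card_half_add false A
  have cB := card_half_add false B
  simp only [Bool.not_false] at cA cB
  obtain ⟨a, ha⟩ := card_pos.1 (by omega : 0 < (half false A).card)
  obtain ⟨b, hb⟩ := card_pos.1 (by omega : 0 < (half true A).card)
  have d0 := (h.restrict_half false).card_add_le_of_mem ha
  have d1 := (h.restrict_half true).card_add_le_of_mem hb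
  have e0 := (h.restrict_half false).card_add_le_of_card_eq_two
  have e1 := (h.restrict_half true).card_add_le_of_card_eq_two
  have f0 := (h.restrict_half false).card_add_le_of_card_eq_three
  have f1 := (h.restrict_half true).card_add_le_of_card_eq_three
  have pw : 2 ^ (n + 2) = 2 * 2 ^ (n + 1) := by ring
  omega

/-- Outside the half containing it, `A` has at least as many neighbours as `A ∪ A.compls` has
elements. If these are at least seven, the weak bound in that half suffices. -/
lemma card_add_le_of_half_eq_zero (hn : 3 ≤ n) (b : Bool) (A B : Finset (Fin (n + 3) → Bool))
    (h : Separated A B) (hA : 3 ≤ (half b A).card) (hB : 3 ≤ (half b B).card)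
    (h0 : (half (!b) A).card = 0) : A.card + B.card + 6 * (n + 3) ≤ 2 ^ (n + 3) + 17 := by
  have s0 := two_mul_card_half_le (half b A) false
  have s1 := two_mul_card_half_le (half b A) true
  have c := card_half_add false (half b A)
  have m := h.card_mirror_add_le b
  have i := (h.restrict_half b).card_add_le_weak (by omega) hA hB
  have i3 := (h.restrict_half b).card_add_le_of_card_eq_three
  have ex := (h.restrict_half b).card_add_le_of_card_mirror_le hA
  have ex6 := (h.restrict_half b).card_add_le_of_card_mirror_eq_six hn
  have cA := card_half_add b A
  have cB := card_half_add b B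
  have pw : 2 ^ (n + 3) = 2 * 2 ^ (n + 2) := by ring
  simp only [Bool.not_false] at c
  omega

/-- The lower bound for the number of vertices outside a separated pair. -/
lemma card_add_le (hn : 6 ≤ n) {A B : Finset (Fin n → Bool)} (h : Separated A B)
    (hA : 3 ≤ A.card) (hB : 3 ≤ B.card) : A.card + B.card + 6 * n ≤ 2 ^ n + 17 := by
  obtain ⟨m, rfl⟩ : ∃ m, n = m + 3 := ⟨n - 3, by omega⟩
  exact card_add_le_succ le_rfl (by omega)
    (fun _ _ h hA hB => h.card_add_le_weak (by omega) hA hB)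
    (card_add_le_of_half_eq_zero (by omega)) h hA hB

end Separated

/-! ### Cuts -/

/-- A vertex with two neighbours whose closed neighbourhoods together have at most `6 * n - 14`
elements. For `n = 5` these are the strings `00000`, `00011` and `01111`, and putting a zero in
front adds at most six elements. -/
lemma exists_card_closedNbhd_union_le {n : ℕ} (hn : 5 ≤ n) :
    ∃ o p q : Fin n → Bool, p ≠ q ∧ (AQ n).Adj o p ∧ (AQ n).Adj o q ∧
      (closedNbhd o ∪ closedNbhd p ∪ closedNbhd q).card + 14 ≤ 6 * n := by
  induction n, hn using Nat.le_induction with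
  | base =>
    refine ⟨fun _ => false, fun i => decide (i.1 < 2), fun i => decide (i.1 < 4),
      ?_, ?_, ?_, ?_⟩ <;> decide +kernel
  | succ n hn ih =>
    obtain ⟨o, p, q, hpq, hop, hoq, hc⟩ := ih
    refine ⟨withBit false o, withBit false p, withBit false q, by simpa using hpq,
      by simpa [AQ_adj_withBit] using hop, by simpa [AQ_adj_withBit] using hoq, ?_⟩
    rw [← card_half_add false]
    simp only [half_union, half_closedNbhd_self, half_closedNbhd_not]
    have h1 := card_union_le (({o, oᶜ} : Finset (Fin n → Bool)) ∪ {p, pᶜ}) {q, qᶜ}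
    have h2 := card_union_le ({o, oᶜ} : Finset (Fin n → Bool)) {p, pᶜ}
    have ho : ({o, oᶜ} : Finset (Fin n → Bool)).card ≤ 2 := card_le_two
    have hp : ({p, pᶜ} : Finset (Fin n → Bool)).card ≤ 2 := card_le_two
    have hq : ({q, qᶜ} : Finset (Fin n → Bool)).card ≤ 2 := card_le_two
    omega

lemma two_lt_encard_supp {V : Type*} {G : SimpleGraph V} {S : Finset V}
    (v : ((S : Set V)ᶜ : Set V)) {T : Finset V} (hT : 3 ≤ T.card)
    (h : ∀ w ∈ T, ∃ hw : w ∈ ((S : Set V)ᶜ : Set V),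
      (G.induce ((S : Set V)ᶜ)).Reachable v ⟨w, hw⟩) :
    ((2 : ℕ) : ℕ∞) < ((G.induce ((S : Set V)ᶜ)).connectedComponentMk v).supp.encard := by
  have hsub : (T : Set V) ⊆
      Subtype.val '' ((G.induce ((S : Set V)ᶜ)).connectedComponentMk v).supp := by
    intro w hw
    obtain ⟨hw', hr⟩ := h w hw
    exact ⟨⟨w, hw'⟩, SimpleGraph.ConnectedComponent.sound hr.symm, rfl⟩
  have h1 := Set.encard_le_encard hsub
  rw [Subtype.val_injective.encard_image, Set.encard_coe_eq_coe_finsetCard] at h1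
  exact lt_of_lt_of_le (by exact_mod_cast hT) h1

/-- The neighbourhood of the three vertices of `exists_card_closedNbhd_union_le` is a cut. A vertex
far from the three has at most four common neighbours with each of them, so that at least five of
its neighbours remain. -/
lemma exists_isExtraVertexCut {n : ℕ} (hn : 8 ≤ n) :
    ∃ S, IsExtraVertexCut (AQ n) 2 S ∧ S.card ≤ 6 * n - 17 := by
  obtain ⟨o, p, q, hpq, hop, hoq, hc⟩ := exists_card_closedNbhd_union_le (by omega : 5 ≤ n)
  set U := closedNbhd o ∪ closedNbhd p ∪ closedNbhd q with hU
  set A : Finset (Fin n → Bool) := {o, p, q} with hA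
  have hAcard : A.card = 3 := card_eq_three.2 ⟨o, p, q, hop.ne, hoq.ne, hpq, rfl⟩
  have hAU : A ⊆ U := by
    intro v hv
    simp only [hA, mem_insert, mem_singleton] at hv
    rcases hv with rfl | rfl | rfl <;> simp [hU]
  have hN (a : Fin n → Bool) (ha : a ∈ A) (w : Fin n → Bool) (haw : (AQ n).Adj a w) : w ∈ U := by
    simp only [hA, mem_insert, mem_singleton] at ha
    rcases ha with rfl | rfl | rfl <;> simp [hU, haw]
  have hoA : o ∈ A := by simp [hA]
  have hAS {a : Fin n → Bool} (ha : a ∈ A) : a ∈ (((U \ A : Finset _) : Set (Fin n → Bool))ᶜ) := by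
    simp [ha]
  have hr (a : Fin n → Bool) (ha : a ∈ A) :
      ((AQ n).induce ((U \ A : Finset _) : Set (Fin n → Bool))ᶜ).Reachable
        ⟨o, hAS hoA⟩ ⟨a, hAS ha⟩ := by
    have ha' := ha
    simp only [hA, mem_insert, mem_singleton] at ha'
    rcases ha' with rfl | rfl | rfl
    · exact SimpleGraph.Reachable.refl _
    · exact SimpleGraph.Adj.reachable hop
    · exact SimpleGraph.Adj.reachable hoq
  refine ⟨U \ A, ⟨fun hpre => ?_, fun C => ?_⟩, ?_⟩
  · obtain ⟨v, hv⟩ : ∃ v, v ∉ U := by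
      by_contra! hall
      have h1 : U.card = 2 ^ n := by rw [eq_univ_of_forall hall]; simp
      have h2 : 6 * n < 2 ^ n := by
        clear * - hn
        induction n, hn using Nat.le_induction with
        | base => norm_num
        | succ n hn ih => rw [pow_succ]; omega
      omega
    have hvS : v ∈ (((U \ A : Finset _) : Set (Fin n → Bool))ᶜ) := by simp [hv]
    have hov := hpre ⟨o, hAS hoA⟩ ⟨v, hvS⟩
    rw [SimpleGraph.reachable_iff_reflTransGen] at hov
    refine hv (hAU ?_)
    -- no edge of the remaining graph leaves `A`
    refine Relation.ReflTransGen.head_induction_on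
      (motive := fun u _ => u.1 ∈ A → v ∈ A) hov id (fun {u w} huw _ ih hu => ih ?_) hoA
    have hw := w.2
    have hwU := hN u.1 hu w.1 huw
    simpa [hwU] using hw
  · induction C using SimpleGraph.ConnectedComponent.ind with | _ v =>
    by_cases hv : v.1 ∈ A
    · exact two_lt_encard_supp v hAcard.ge fun w hw =>
        ⟨hAS hw, (hr v.1 hv).symm.trans (hr w hw)⟩
    · have hvU : v.1 ∉ U := by
        intro hvU
        have := v.2
        simp_all
      have hi (a : Fin n → Bool) (ha : a ∈ A) : (closedNbhd v.1 ∩ closedNbhd a).card ≤ 4 := by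
        refine (card_closedNbhd_inter_le ?_).resolve_right fun h => hvU (hN a ha _ h.1.symm)
        rintro rfl
        exact hv ha
      have ho := hi o hoA
      have hp := hi p (by simp [hA])
      have hq := hi q (by simp [hA])
      have hle : (closedNbhd v.1 ∩ (U \ A)).card ≤ 12 := by
        have hs : closedNbhd v.1 ∩ (U \ A) ⊆ (closedNbhd v.1 ∩ closedNbhd o) ∪
            (closedNbhd v.1 ∩ closedNbhd p) ∪ (closedNbhd v.1 ∩ closedNbhd q) := by
          rw [← inter_union_distrib_left, ← inter_union_distrib_left]
          exact inter_subset_inter_left sdiff_subset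
        have h1 := card_le_card hs
        have h2 := card_union_le ((closedNbhd v.1 ∩ closedNbhd o) ∪
            (closedNbhd v.1 ∩ closedNbhd p)) (closedNbhd v.1 ∩ closedNbhd q)
        have h3 := card_union_le (closedNbhd v.1 ∩ closedNbhd o) (closedNbhd v.1 ∩ closedNbhd p)
        omega
      have hcv : (closedNbhd v.1).card = 2 * n := by
        obtain ⟨m, rfl⟩ : ∃ m, n = m + 1 := ⟨n - 1, by omega⟩
        exact card_closedNbhd _
      have hT : 3 ≤ (closedNbhd v.1 \ (U \ A)).card := by
        have := card_sdiff_add_card_inter (closedNbhd v.1) (U \ A)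
        omega
      refine two_lt_encard_supp v hT fun w hw => ?_
      obtain ⟨hw, hwS⟩ := mem_sdiff.1 hw
      refine ⟨by simpa using hwS, ?_⟩
      rcases mem_closedNbhd.1 hw with rfl | hw
      · exact SimpleGraph.Reachable.refl _
      · exact SimpleGraph.Adj.reachable hw
  · rw [card_sdiff_of_subset hAU, hAcard]
    omega

/-- A component of the remaining graph and the union of the other components form a separated
pair. -/
lemma le_card_of_isExtraVertexCut {n : ℕ} (hn : 6 ≤ n) {S : Finset (Fin n → Bool)}
    (h : IsExtraVertexCut (AQ n) 2 S) : 6 * n - 17 ≤ S.card := by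
  classical
  obtain ⟨hd, hc⟩ := h
  simp only [SimpleGraph.Preconnected, not_forall] at hd
  obtain ⟨u, v, huv⟩ := hd
  set H := (AQ n).induce ((S : Set (Fin n → Bool))ᶜ) with hH
  let A : Finset (Fin n → Bool) := univ.filter fun w => ∃ hw, H.Reachable u ⟨w, hw⟩
  let B : Finset (Fin n → Bool) := univ \ (A ∪ S)
  have three_le {T : Finset (Fin n → Bool)} (w : ((S : Set (Fin n → Bool))ᶜ : Set _))
      (hT : ∀ x, H.Reachable w x → x.1 ∈ T) : 3 ≤ T.card := by
    have h1 : Subtype.val '' (H.connectedComponentMk w).supp ⊆ (T : Set (Fin n → Bool)) := by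
      rintro _ ⟨x, hx, rfl⟩
      exact hT x (SimpleGraph.ConnectedComponent.exact hx).symm
    have h2 := Set.encard_le_encard h1
    rw [Subtype.val_injective.encard_image, Set.encard_coe_eq_coe_finsetCard] at h2
    have h3 := (hc (H.connectedComponentMk w)).trans_le h2
    exact_mod_cast h3
  have hA : 3 ≤ A.card := three_le u fun x hx => by
    simp only [A, mem_filter, mem_univ, true_and]
    exact ⟨x.2, hx⟩
  have hB : 3 ≤ B.card := three_le v fun x hx => by
    simp only [B, A, mem_sdiff, mem_univ, true_and, mem_union, mem_filter, not_or]
    exact ⟨fun ⟨_, h⟩ => huv (h.trans hx.symm), x.2⟩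
  have hsep : Separated A B := by
    intro a ha b hb hab
    simp only [B, mem_sdiff, mem_univ, true_and, mem_union, not_or] at hb
    have ha' := ha
    simp only [A, mem_filter, mem_univ, true_and] at ha'
    obtain ⟨haS, hr⟩ := ha'
    rcases mem_closedNbhd.1 hab with rfl | hab
    · exact hb.1 ha
    · refine hb.1 ?_
      simp only [A, mem_filter, mem_univ, true_and]
      have hab' : H.Adj ⟨a, haS⟩ ⟨b, hb.2⟩ := hab
      exact ⟨hb.2, hr.trans hab'.reachable⟩
  have h1 := hsep.card_add_le hn hA hB
  have h2 : B.card + (A ∪ S).card = 2 ^ n := by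
    have := card_sdiff_add_card_eq_card (subset_univ (A ∪ S))
    simpa [B] using this
  have h3 := card_union_le A S
  omega

theorem theorem3p1 (n : ℕ) (hn : 9 ≤ n) :
    extraConnectivity 2 (AQ n) = ((6 * n - 17 : ℕ) : ℕ∞) := by
  refine le_antisymm ?_ (le_iInf₂ fun S hS => ?_)
  · obtain ⟨S, hS, hc⟩ := exists_isExtraVertexCut (by omega : 8 ≤ n)
    exact (iInf₂_le S hS).trans (by exact_mod_cast hc)
  · exact_mod_cast le_card_of_isExtraVertexCut (by omega) hS
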